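/- Let $k$ be a positive integer with $k\equiv 1 \pmod 5$. Then \[ n=\frac{512k^5+1280k^4+6560k^3+9520k^2+6100k+1028}{3125} \] is a positive integer, and there is an undirected Cayley graph on five generators of the cyclic group $\mathbb{Z}_n$ (a circulant graph of order $n$) which has diameter exactly $k$. Moreover, a generating set is $G=\{1,g_2,g_3,g_4,g_5\}$ (read modulo $n$), where \[ g_2=\frac{128k^4+448k^3+1688k^2+3768k+843}{625},\qquad g_3=\frac{256k^4+416k^3+2816k^2+2346k+416}{625}, \] \[ g_4=\frac{256k^4+576k^3+3136k^2+3976k+1431}{625},\qquad g_5=\frac{384k^4+864k^3+4504k^2+5614k+1134}{625} \] are integers and the five elements of $G$ are pairwise distinct modulo $n$. That is, the graph with vertex set $\mathbb{Z}_n$, in which distinct $x,y$ are adjacent if and only if $x-y\in G\cup(-G)$, has order $n$ and diameter $k$. For every such $k\ge 6$ this graph is regular of degree $10$. -/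

import Mathlib

/-! Write k = 5t + 1. The distance from 0 to a is the least ℓ¹-norm of an integer vector z with
`eval t z` ≡ a, so the diameter concerns the lattice R of relations in ℤ⁵. R contains, with index
two, the lattice L spanned by the columns of M = 4t·I + D + A, where D = diag(1,2,1,1,1) and A is
skew-symmetric with entries 0, ±1. The other coset is h + L, where h is half the sum of the columns.

Upper bound: every integer vector must lie within 5t + 1 of R. Subtracting relations moves it into
the cube |x_i| ≤ 2t + 2 (`exists_abs_le`). A point in a box with one corner in L and the opposite
corner in h + L has distances to these corners that add up to the ℓ¹-distance of the corners. By
skew-symmetry this is 10t + 3 for all the boxes used, so one corner is within 5t + 1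
(`exists_relation_of_mem_latticeBox`). That such boxes cover half of the cube is a finite
computation, uniform in t ≥ 2 because the box sides are affine in t (`covers_symbolic`); x ↦ -x
gives the other half.

Lower bound: translating (t+1, t, t, t, t) by R never shortens it, by diagonal dominance of M
(`add_le_abs_sub_lattice`), if t ≥ 2. The cases t = 0 and t = 1 are finite checks. -/

/-! ### Certified covering of boxes whose sides depend affinely on a parameter. -/

namespace BoxCover

/-- The affine function `(base - 64) + (slope - 16) * (d - 1)` of `d`. -/
structure Endpoint where
  base : ℕ
  slope : ℕ

structure Interval where
  lo : Endpoint
  hi : Endpoint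

/-- A product of five half-open intervals. -/
structure Box where
  x1 : Interval
  x2 : Interval
  x3 : Interval
  x4 : Interval
  x5 : Interval

namespace Endpoint

def value (d : ℕ) (e : Endpoint) : ℤ := (e.base - 64) + (e.slope - 16) * (d - 1)

/-- The order of endpoints that holds for all `d ≥ 0`. -/
def le (e f : Endpoint) : Bool :=
  -- Comparison at `d = 0`, where the value is `base - slope - 48`, together with comparison of
  -- slopes.
  and (Nat.ble (e.base + f.slope) (f.base + e.slope)) (Nat.ble e.slope f.slope)

theorem value_le_of_le {d : ℕ} {e f : Endpoint} (h : e.le f = true) : e.value d ≤ f.value d := by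
  simp only [le, Bool.and_eq_true, Nat.ble_eq] at h
  have h1 : (e.base + f.slope : ℤ) ≤ f.base + e.slope := by exact_mod_cast h.1
  have h2 : (e.slope : ℤ) ≤ f.slope := by exact_mod_cast h.2
  have h3 : (0 : ℤ) ≤ d := by positivity
  unfold value
  nlinarith

end Endpoint

namespace Interval

def Mem (d : ℕ) (r : Interval) (x : ℤ) : Prop := r.lo.value d ≤ x ∧ x < r.hi.value d

/-- Whether two nonempty intervals meet when `d = 1`. -/
def meets (r b : Interval) : Bool :=
  and (Nat.ble b.lo.base.succ r.hi.base) (Nat.ble r.lo.base.succ b.hi.base)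

/-- The number of integers in the intersection of two intervals when `d = 1`. -/
def overlap (r b : Interval) : ℕ :=
  cond (Nat.ble r.hi.base b.hi.base) r.hi.base b.hi.base -
    cond (Nat.ble r.lo.base b.lo.base) b.lo.base r.lo.base

/-- Endpoints may be incomparable uniformly in `d`; either choice then still bounds the
intersection. -/
def inter (r b : Interval) : Interval :=
  ⟨cond (b.lo.le r.lo) r.lo b.lo, cond (r.hi.le b.hi) r.hi b.hi⟩

theorem mem_inter {d : ℕ} {r b : Interval} {x : ℤ} (hr : r.Mem d x) (hb : b.Mem d x) :
    (r.inter b).Mem d x := by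
  constructor
  · cases h : b.lo.le r.lo <;> simp only [inter, h, cond]
    exacts [hb.1, hr.1]
  · cases h : r.hi.le b.hi <;> simp only [inter, h, cond]
    exacts [hb.2, hr.2]

/-- The conditions `= false` are those under which `Box.diff` keeps the corresponding piece. -/
theorem mem_cases {d : ℕ} {r : Interval} {x : ℤ} (b : Interval) (hr : r.Mem d x) :
    (b.lo.le r.lo = false ∧ Mem d ⟨r.lo, b.lo⟩ x) ∨ (r.hi.le b.hi = false ∧ Mem d ⟨b.hi, r.hi⟩ x) ∨
      b.Mem d x ∧ (r.inter b).Mem d x := by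
  by_cases hlo : b.lo.value d ≤ x
  · by_cases hhi : x < b.hi.value d
    · exact Or.inr (Or.inr ⟨⟨hlo, hhi⟩, mem_inter hr ⟨hlo, hhi⟩⟩)
    · refine Or.inr (Or.inl ⟨?_, not_lt.1 hhi, hr.2⟩)
      by_contra hc
      exact hhi (hr.2.trans_le (Endpoint.value_le_of_le (Bool.eq_true_of_not_eq_false hc)))
  · refine Or.inl ⟨?_, hr.1, not_le.1 hlo⟩
    by_contra hc
    exact hlo ((Endpoint.value_le_of_le (Bool.eq_true_of_not_eq_false hc)).trans hr.1)

end Interval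

namespace Box

def Mem (d : ℕ) (r : Box) (x1 x2 x3 x4 x5 : ℤ) : Prop :=
  r.x1.Mem d x1 ∧ r.x2.Mem d x2 ∧ r.x3.Mem d x3 ∧ r.x4.Mem d x4 ∧ r.x5.Mem d x5

def meets (r b : Box) : Bool :=
  and (r.x1.meets b.x1) (and (r.x2.meets b.x2)
    (and (r.x3.meets b.x3) (and (r.x4.meets b.x4) (r.x5.meets b.x5))))

def overlap (r b : Box) : ℕ :=
  r.x1.overlap b.x1 * (r.x2.overlap b.x2 *
    (r.x3.overlap b.x3 * (r.x4.overlap b.x4 * r.x5.overlap b.x5)))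

/-- Boxes that cover the part of the first box outside the second. -/
def diff (r b : Box) : List Box :=
  let y1 := r.x1.inter b.x1
  let y2 := r.x2.inter b.x2
  let y3 := r.x3.inter b.x3
  let y4 := r.x4.inter b.x4
  let consUnless (c : Bool) (p : Box) (l : List Box) : List Box := cond c l (p :: l)
  consUnless (b.x1.lo.le r.x1.lo) ⟨⟨r.x1.lo, b.x1.lo⟩, r.x2, r.x3, r.x4, r.x5⟩ <|
  consUnless (r.x1.hi.le b.x1.hi) ⟨⟨b.x1.hi, r.x1.hi⟩, r.x2, r.x3, r.x4, r.x5⟩ <|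
  consUnless (b.x2.lo.le r.x2.lo) ⟨y1, ⟨r.x2.lo, b.x2.lo⟩, r.x3, r.x4, r.x5⟩ <|
  consUnless (r.x2.hi.le b.x2.hi) ⟨y1, ⟨b.x2.hi, r.x2.hi⟩, r.x3, r.x4, r.x5⟩ <|
  consUnless (b.x3.lo.le r.x3.lo) ⟨y1, y2, ⟨r.x3.lo, b.x3.lo⟩, r.x4, r.x5⟩ <|
  consUnless (r.x3.hi.le b.x3.hi) ⟨y1, y2, ⟨b.x3.hi, r.x3.hi⟩, r.x4, r.x5⟩ <|
  consUnless (b.x4.lo.le r.x4.lo) ⟨y1, y2, y3, ⟨r.x4.lo, b.x4.lo⟩, r.x5⟩ <|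
  consUnless (r.x4.hi.le b.x4.hi) ⟨y1, y2, y3, ⟨b.x4.hi, r.x4.hi⟩, r.x5⟩ <|
  consUnless (b.x5.lo.le r.x5.lo) ⟨y1, y2, y3, y4, ⟨r.x5.lo, b.x5.lo⟩⟩ <|
  consUnless (r.x5.hi.le b.x5.hi) ⟨y1, y2, y3, y4, ⟨b.x5.hi, r.x5.hi⟩⟩ []

/-- The box of a list with the largest overlap with `r`, if that exceeds `m`; else `o`. -/
def best (r : Box) : List Box → ℕ → Option Box → Option Box
  | [], _, o => o
  | b :: bs, m, o => cond (Nat.ble (r.overlap b) m) (best r bs m o) (best r bs (r.overlap b) (some b))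

/-- A search, of depth bounded by the first argument, for a proof that boxes of the list
cover the box `r`. -/
def covers : ℕ → List Box → Box → Bool
  | 0, _, _ => false
  | f + 1, bs, r =>
    match best r (bs.filter r.meets) 0 none with
    | none => false
    | some b => (r.diff b).all (covers f (bs.filter r.meets))

theorem mem_or_mem_diff {d : ℕ} {r : Box} {x1 x2 x3 x4 x5 : ℤ} (b : Box)
    (h : r.Mem d x1 x2 x3 x4 x5) :
    b.Mem d x1 x2 x3 x4 x5 ∨ ∃ p ∈ r.diff b, p.Mem d x1 x2 x3 x4 x5 := by
  have cons_self : ∀ {c : Bool} {p : Box} {l : List Box}, c = false → p ∈ cond c l (p :: l) := by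
    rintro _ p l rfl
    exact List.mem_cons_self
  have cons_of_mem : ∀ {c : Bool} {p q : Box} {l : List Box}, p ∈ l → p ∈ cond c l (q :: l) := by
    rintro (_ | _) p q l h
    exacts [List.mem_cons_of_mem _ h, h]
  obtain ⟨h1, h2, h3, h4, h5⟩ := h
  obtain ⟨hc, hm⟩ | ⟨hc, hm⟩ | ⟨hb1, hi1⟩ := Interval.mem_cases b.x1 h1
  · exact Or.inr ⟨_, cons_self hc, hm, h2, h3, h4, h5⟩
  · exact Or.inr ⟨_, cons_of_mem (cons_self hc), hm, h2, h3, h4, h5⟩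
  obtain ⟨hc, hm⟩ | ⟨hc, hm⟩ | ⟨hb2, hi2⟩ := Interval.mem_cases b.x2 h2
  · exact Or.inr ⟨_, cons_of_mem (cons_of_mem (cons_self hc)), hi1, hm, h3, h4, h5⟩
  · exact Or.inr ⟨_, cons_of_mem (cons_of_mem (cons_of_mem (cons_self hc))), hi1, hm, h3, h4, h5⟩
  obtain ⟨hc, hm⟩ | ⟨hc, hm⟩ | ⟨hb3, hi3⟩ := Interval.mem_cases b.x3 h3
  · exact Or.inr ⟨_, cons_of_mem (cons_of_mem (cons_of_mem (cons_of_mem (cons_self hc)))),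
      hi1, hi2, hm, h4, h5⟩
  · exact Or.inr ⟨_, cons_of_mem (cons_of_mem (cons_of_mem (cons_of_mem (cons_of_mem
      (cons_self hc))))), hi1, hi2, hm, h4, h5⟩
  obtain ⟨hc, hm⟩ | ⟨hc, hm⟩ | ⟨hb4, hi4⟩ := Interval.mem_cases b.x4 h4
  · exact Or.inr ⟨_, cons_of_mem (cons_of_mem (cons_of_mem (cons_of_mem (cons_of_mem
      (cons_of_mem (cons_self hc)))))), hi1, hi2, hi3, hm, h5⟩
  · exact Or.inr ⟨_, cons_of_mem (cons_of_mem (cons_of_mem (cons_of_mem (cons_of_mem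
      (cons_of_mem (cons_of_mem (cons_self hc))))))), hi1, hi2, hi3, hm, h5⟩
  obtain ⟨hc, hm⟩ | ⟨hc, hm⟩ | ⟨hb5, hi5⟩ := Interval.mem_cases b.x5 h5
  · exact Or.inr ⟨_, cons_of_mem (cons_of_mem (cons_of_mem (cons_of_mem (cons_of_mem
      (cons_of_mem (cons_of_mem (cons_of_mem (cons_self hc)))))))), hi1, hi2, hi3, hi4, hm⟩
  · exact Or.inr ⟨_, cons_of_mem (cons_of_mem (cons_of_mem (cons_of_mem (cons_of_mem
      (cons_of_mem (cons_of_mem (cons_of_mem (cons_of_mem (cons_self hc))))))))),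
      hi1, hi2, hi3, hi4, hm⟩
  exact Or.inl ⟨hb1, hb2, hb3, hb4, hb5⟩

theorem mem_of_best_eq_some {r b : Box} : ∀ {bs : List Box} {m : ℕ} {o : Option Box},
    best r bs m o = some b → b ∈ bs ∨ o = some b
  | [], _, _, h => Or.inr h
  | a :: bs, m, o, h => by
    rw [best] at h
    cases hc : Nat.ble (r.overlap a) m <;> rw [hc] at h
    · refine Or.inl ?_
      obtain h | h := mem_of_best_eq_some h
      · exact List.mem_cons_of_mem _ h
      · obtain rfl := Option.some.inj h
        exact List.mem_cons_self
    · exact (mem_of_best_eq_some h).imp_left (List.mem_cons_of_mem _)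

/-- Soundness rests on `Endpoint.le` alone. `meets` and `overlap`, computed at `d = 1`, only steer
the search: a bad choice can make it fail but cannot make it wrong. -/
theorem exists_mem_of_covers {d : ℕ} {x1 x2 x3 x4 x5 : ℤ} : ∀ {f : ℕ} {bs : List Box} {r : Box},
    covers f bs r = true → r.Mem d x1 x2 x3 x4 x5 → ∃ b ∈ bs, b.Mem d x1 x2 x3 x4 x5
  | 0, _, _, h, _ => by simp [covers] at h
  | f + 1, bs, r, h, hx => by
    rw [covers] at h
    split at h
    · simp at h
    · rename_i b hb
      obtain hb | hb := mem_of_best_eq_some hb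
      · obtain hx' | ⟨p, hp, hpx⟩ := mem_or_mem_diff b hx
        · exact ⟨b, List.mem_of_mem_filter hb, hx'⟩
        · obtain ⟨c, hc, hcx⟩ := exists_mem_of_covers (List.all_eq_true.1 h p hp) hpx
          exact ⟨c, List.mem_of_mem_filter hc, hcx⟩
      · simp at hb

end Box

end BoxCover

/-! ### Distances in circulant graphs as ℓ¹-norms of coefficient vectors. -/

namespace SimpleGraph

variable {A : Type*} [AddCommGroup A] {S : Set A}

theorem circulantGraph_edist_add_nsmul_le {s : A} (hs : s ∈ S) (u : A) (j : ℕ) :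
    (circulantGraph S).edist u (u + j • s) ≤ j := by
  induction j with
  | zero => simp
  | succ j ih =>
    refine (SimpleGraph.edist_triangle (v := u + j • s)).trans ?_
    push_cast
    refine add_le_add ih ?_
    rw [edist_le_one_iff_adj_or_eq, or_iff_not_imp_right]
    intro h
    rw [circulantGraph_adj]
    exact ⟨h, Or.inr (by rw [succ_nsmul]; convert hs using 1; abel)⟩

theorem circulantGraph_edist_add_zsmul_le {s : A} (hs : s ∈ S) (u : A) (m : ℤ) :
    (circulantGraph S).edist u (u + m • s) ≤ m.natAbs := by
  obtain ⟨j, rfl | rfl⟩ := Int.eq_nat_or_neg m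
  · simpa using circulantGraph_edist_add_nsmul_le hs u j
  · rw [edist_comm]
    simpa using circulantGraph_edist_add_nsmul_le hs (u + (-j : ℤ) • s) j

theorem circulantGraph_edist_le {s1 s2 s3 s4 s5 : A} (u : A) (z1 z2 z3 z4 z5 : ℤ) :
    (circulantGraph {s1, s2, s3, s4, s5}).edist u
      (u + (z1 • s1 + z2 • s2 + z3 • s3 + z4 • s4 + z5 • s5)) ≤
      ((z1.natAbs + z2.natAbs + z3.natAbs + z4.natAbs + z5.natAbs : ℕ) : ℕ∞) := by
  simp only [← add_assoc]
  push_cast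
  refine SimpleGraph.edist_triangle.trans (add_le_add ?_
    (circulantGraph_edist_add_zsmul_le (by simp) _ _))
  refine SimpleGraph.edist_triangle.trans (add_le_add ?_
    (circulantGraph_edist_add_zsmul_le (by simp) _ _))
  refine SimpleGraph.edist_triangle.trans (add_le_add ?_
    (circulantGraph_edist_add_zsmul_le (by simp) _ _))
  exact SimpleGraph.edist_triangle.trans (add_le_add
    (circulantGraph_edist_add_zsmul_le (by simp) _ _)
    (circulantGraph_edist_add_zsmul_le (by simp) _ _))

theorem exists_eq_add_of_walk_circulantGraph {s1 s2 s3 s4 s5 u v : A}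
    (p : (circulantGraph {s1, s2, s3, s4, s5}).Walk u v) : ∃ z1 z2 z3 z4 z5 : ℤ,
      v = u + (z1 • s1 + z2 • s2 + z3 • s3 + z4 • s4 + z5 • s5) ∧
      z1.natAbs + z2.natAbs + z3.natAbs + z4.natAbs + z5.natAbs ≤ p.length := by
  induction p with
  | nil => exact ⟨0, 0, 0, 0, 0, by simp, by simp⟩
  | @cons u w v h p ih =>
    obtain ⟨z1, z2, z3, z4, z5, rfl, hz⟩ := ih
    rw [Walk.length_cons]
    rw [circulantGraph_adj] at h
    obtain ⟨-, h | h⟩ := h <;>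
      simp only [Set.mem_insert_iff, Set.mem_singleton_iff] at h <;>
      obtain h | h | h | h | h := h
    · exact ⟨z1 - 1, z2, z3, z4, z5, by rw [← h]; module, by omega⟩
    · exact ⟨z1, z2 - 1, z3, z4, z5, by rw [← h]; module, by omega⟩
    · exact ⟨z1, z2, z3 - 1, z4, z5, by rw [← h]; module, by omega⟩
    · exact ⟨z1, z2, z3, z4 - 1, z5, by rw [← h]; module, by omega⟩
    · exact ⟨z1, z2, z3, z4, z5 - 1, by rw [← h]; module, by omega⟩
    · exact ⟨z1 + 1, z2, z3, z4, z5, by rw [← h]; module, by omega⟩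
    · exact ⟨z1, z2 + 1, z3, z4, z5, by rw [← h]; module, by omega⟩
    · exact ⟨z1, z2, z3 + 1, z4, z5, by rw [← h]; module, by omega⟩
    · exact ⟨z1, z2, z3, z4 + 1, z5, by rw [← h]; module, by omega⟩
    · exact ⟨z1, z2, z3, z4, z5 + 1, by rw [← h]; module, by omega⟩

/-- The diameter of a circulant graph on five generators, in terms of the representations of the
elements of the group by the generators. -/
theorem ediam_circulantGraph_eq {s1 s2 s3 s4 s5 : A} {k : ℕ}
    (hle : ∀ a : A, ∃ z1 z2 z3 z4 z5 : ℤ,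
      a = z1 • s1 + z2 • s2 + z3 • s3 + z4 • s4 + z5 • s5 ∧
      z1.natAbs + z2.natAbs + z3.natAbs + z4.natAbs + z5.natAbs ≤ k)
    (hge : ∃ a : A, ∀ z1 z2 z3 z4 z5 : ℤ,
      a = z1 • s1 + z2 • s2 + z3 • s3 + z4 • s4 + z5 • s5 →
      k ≤ z1.natAbs + z2.natAbs + z3.natAbs + z4.natAbs + z5.natAbs) :
    (circulantGraph {s1, s2, s3, s4, s5}).ediam = k := by
  refine le_antisymm (ediam_le_of_edist_le fun u v => ?_) ?_
  · obtain ⟨z1, z2, z3, z4, z5, h, hz⟩ := hle (v - u)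
    have := circulantGraph_edist_le (s1 := s1) (s2 := s2) (s3 := s3) (s4 := s4) (s5 := s5)
      u z1 z2 z3 z4 z5
    rw [← h, add_sub_cancel] at this
    exact this.trans (by exact_mod_cast hz)
  · obtain ⟨a, ha⟩ := hge
    refine le_trans ?_ (edist_le_ediam (u := 0) (v := a))
    rw [edist_eq_sInf]
    refine le_sInf ?_
    rintro _ ⟨p, rfl⟩
    obtain ⟨z1, z2, z3, z4, z5, h, hz⟩ := exists_eq_add_of_walk_circulantGraph p
    rw [zero_add] at h
    exact Nat.cast_le.2 ((ha _ _ _ _ _ h).trans hz)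

end SimpleGraph

/-! ### The relation lattice and the covering of the cube. -/

namespace Degree10

open BoxCover

/-- The code of the function `a * t + b` of `t = T + d - 1` if `σ = 1`, of `t = T` if `σ = 0`. -/
def endpoint (T σ : ℕ) (a b : ℤ) : Endpoint := ⟨(a * T + b + 64).toNat, (σ * a + 16).toNat⟩

/-- The integers from `4 * m * t + b` to `(4 * m + 2) * t + b'` if `e = 0`, those from
`(4 * m - 2) * t + b'` to `4 * m * t + b` otherwise. -/
def side (T σ : ℕ) (m e b b' : ℤ) : Interval :=
  if e = 0 then ⟨endpoint T σ (4 * m) b, endpoint T σ (4 * m + 2) (b' + 1)⟩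
  else ⟨endpoint T σ (4 * m - 2) b', endpoint T σ (4 * m) (b + 1)⟩

/-! The vectors `(4 * m1 * t + shift1 ..., ..., 4 * m5 * t + shift5 ...)` form a lattice of relations
between the generators; its index in the lattice of all relations is two. -/

def shift1 (m1 m2 m3 m5 : ℤ) : ℤ := m1 + m2 + m3 - m5
def shift2 (m1 m2 m4 : ℤ) : ℤ := -m1 + 2 * m2 + m4
def shift3 (m1 m3 m4 m5 : ℤ) : ℤ := -m1 + m3 + m4 - m5
def shift4 (m2 m3 m4 m5 : ℤ) : ℤ := -m2 - m3 + m4 + m5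
def shift5 (m1 m3 m4 m5 : ℤ) : ℤ := m1 + m3 - m4 + m5

/-- The box between the lattice point with coordinates `m` and the sum of the half-period
`(2 * t + 1, 2 * t + 1, 2 * t, 2 * t, 2 * t + 1)` and the lattice point with coordinates `m - e`. -/
def latticeBox (T σ : ℕ) (m1 m2 m3 m4 m5 e1 e2 e3 e4 e5 : ℤ) : Box where
  x1 := side T σ m1 e1 (shift1 m1 m2 m3 m5) (shift1 (m1 - e1) (m2 - e2) (m3 - e3) (m5 - e5) + 1)
  x2 := side T σ m2 e2 (shift2 m1 m2 m4) (shift2 (m1 - e1) (m2 - e2) (m4 - e4) + 1)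
  x3 := side T σ m3 e3 (shift3 m1 m3 m4 m5) (shift3 (m1 - e1) (m3 - e3) (m4 - e4) (m5 - e5))
  x4 := side T σ m4 e4 (shift4 m2 m3 m4 m5) (shift4 (m2 - e2) (m3 - e3) (m4 - e4) (m5 - e5))
  x5 := side T σ m5 e5 (shift5 m1 m3 m4 m5) (shift5 (m1 - e1) (m3 - e3) (m4 - e4) (m5 - e5) + 1)

def latticeBoxes (T σ : ℕ) : List Box :=
  [0, 1].flatMap fun m1 => [0, 1, -1].flatMap fun m2 => [0, 1, -1].flatMap fun m3 =>
  [0, 1, -1].flatMap fun m4 => [0, 1, -1].flatMap fun m5 =>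
  [0, 1].flatMap fun e1 => [0, 1].flatMap fun e2 => [0, 1].flatMap fun e3 =>
  [0, 1].flatMap fun e4 => [0, 1].map fun e5 => latticeBox T σ m1 m2 m3 m4 m5 e1 e2 e3 e4 e5

/-- The part with `0 ≤ x1` of the cube where every coordinate has absolute value `≤ 2 * t + 2`. -/
def halfCube (T σ : ℕ) : Box :=
  let i : Interval := ⟨endpoint T σ (-2) (-2), endpoint T σ 2 3⟩
  ⟨⟨endpoint T σ 0 0, endpoint T σ 2 3⟩, i, i, i, i⟩

-- With `T = 3` and `σ = 1` the parameter is t = d + 2, so this single run settles all t ≥ 2. With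
-- `σ = 0` the endpoints are constants, for the remaining case t = 1.
set_option maxRecDepth 100000 in
theorem covers_symbolic : Box.covers 30 (latticeBoxes 3 1) (halfCube 3 1) = true := by
  decide +kernel

set_option maxRecDepth 100000 in
theorem covers_one : Box.covers 30 (latticeBoxes 1 0) (halfCube 1 0) = true := by
  decide +kernel

/-- The offsets 64 and 16 let signed coefficients be coded by natural numbers; the hypotheses say
that `toNat` does not truncate. -/
theorem value_endpoint {T σ d : ℕ} {t a b : ℤ} (ht : t = T + σ * ((d : ℤ) - 1))
    (hb : 0 ≤ a * T + b + 64) (hs : 0 ≤ σ * a + 16) :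
    (endpoint T σ a b).value d = a * t + b := by
  simp only [endpoint, Endpoint.value, Int.toNat_of_nonneg hb, Int.toNat_of_nonneg hs, ht]
  ring

/-- `x` lies between the two corner coordinates, so its distances to them add up to the side length;
`e` tells which corner is the upper one. -/
theorem abs_add_abs_of_mem_side {T σ d : ℕ} {t m e b b' x : ℤ} (hT : T ≤ 3) (hσ : σ ≤ 1)
    (ht : t = T + σ * ((d : ℤ) - 1)) (hm : |m| ≤ 1) (he : e = 0 ∨ e = 1) (hb : |b| ≤ 10)
    (hb' : |b'| ≤ 10) (hx : (side T σ m e b b').Mem d x) :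
    |x - (4 * m * t + b)| + |x - ((4 * (m - e) + 2) * t + b')| =
      (1 - 2 * e) * ((2 - 4 * e) * t + b' - b) := by
  rw [abs_le] at hm hb hb'
  have hval : ∀ a c : ℤ, |a| ≤ 6 → |c| ≤ 11 → (endpoint T σ a c).value d = a * t + c := by
    intro a c ha hc
    rw [abs_le] at ha hc
    refine value_endpoint ht ?_ ?_
    · nlinarith
    · nlinarith
  obtain ⟨h1, h2⟩ := hx
  obtain rfl | rfl := he
  · simp only [side, if_true] at h1 h2
    rw [hval _ _ (by rw [abs_le]; omega) (by rw [abs_le]; omega)] at h1 h2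
    rw [abs_of_nonneg (by linarith), abs_of_nonpos (by linarith)]
    ring
  · simp only [side, one_ne_zero, if_false] at h1 h2
    rw [hval _ _ (by rw [abs_le]; omega) (by rw [abs_le]; omega)] at h1 h2
    rw [abs_of_nonpos (by linarith), abs_of_nonneg (by linarith)]
    ring

/-- The order of the graph of diameter `5 * t + 1`. -/
def order (t : ℕ) : ℕ := 512 * t ^ 5 + 768 * t ^ 4 + 672 * t ^ 3 + 336 * t ^ 2 + 84 * t + 8

def gen2 (t : ℕ) : ℕ := 128 * t ^ 4 + 192 * t ^ 3 + 152 * t ^ 2 + 72 * t + 11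
def gen3 (t : ℕ) : ℕ := 256 * t ^ 4 + 288 * t ^ 3 + 224 * t ^ 2 + 82 * t + 10
def gen4 (t : ℕ) : ℕ := 256 * t ^ 4 + 320 * t ^ 3 + 256 * t ^ 2 + 104 * t + 15
def gen5 (t : ℕ) : ℕ := 384 * t ^ 4 + 480 * t ^ 3 + 376 * t ^ 2 + 150 * t + 20

/-- The combination of the generators with given coefficients. -/
def eval (t : ℕ) (z1 z2 z3 z4 z5 : ℤ) : ℤ :=
  z1 + z2 * gen2 t + z3 * gen3 t + z4 * gen4 t + z5 * gen5 t

theorem eval_lattice (t : ℕ) (m1 m2 m3 m4 m5 : ℤ) :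
    eval t (4 * m1 * t + shift1 m1 m2 m3 m5) (4 * m2 * t + shift2 m1 m2 m4)
      (4 * m3 * t + shift3 m1 m3 m4 m5) (4 * m4 * t + shift4 m2 m3 m4 m5)
      (4 * m5 * t + shift5 m1 m3 m4 m5) = order t * (m2 + 2 * m3 + 2 * m4 + 3 * m5) := by
  simp only [eval, order, gen2, gen3, gen4, gen5, shift1, shift2, shift3, shift4, shift5]
  push_cast
  ring

theorem eval_lattice_add_half (t : ℕ) (m1 m2 m3 m4 m5 : ℤ) :
    eval t ((4 * m1 + 2) * t + (shift1 m1 m2 m3 m5 + 1)) ((4 * m2 + 2) * t + (shift2 m1 m2 m4 + 1))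
      ((4 * m3 + 2) * t + shift3 m1 m3 m4 m5) ((4 * m4 + 2) * t + shift4 m2 m3 m4 m5)
      ((4 * m5 + 2) * t + (shift5 m1 m3 m4 m5 + 1)) =
      order t * (m2 + 2 * m3 + 2 * m4 + 3 * m5 + 4) := by
  simp only [eval, order, gen2, gen3, gen4, gen5, shift1, shift2, shift3, shift4, shift5]
  push_cast
  ring

/-- Every relation between the generators modulo `order t` is a lattice point, or a lattice point
plus the half-period. -/
theorem exists_lattice_of_dvd_eval {t : ℕ} {w1 w2 w3 w4 w5 : ℤ}
    (h : (order t : ℤ) ∣ eval t w1 w2 w3 w4 w5) : ∃ m1 m2 m3 m4 m5 : ℤ,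
    (w1 = 4 * m1 * t + shift1 m1 m2 m3 m5 ∧ w2 = 4 * m2 * t + shift2 m1 m2 m4 ∧
      w3 = 4 * m3 * t + shift3 m1 m3 m4 m5 ∧ w4 = 4 * m4 * t + shift4 m2 m3 m4 m5 ∧
      w5 = 4 * m5 * t + shift5 m1 m3 m4 m5) ∨
    (w1 = (4 * m1 + 2) * t + (shift1 m1 m2 m3 m5 + 1) ∧
      w2 = (4 * m2 + 2) * t + (shift2 m1 m2 m4 + 1) ∧
      w3 = (4 * m3 + 2) * t + shift3 m1 m3 m4 m5 ∧ w4 = (4 * m4 + 2) * t + shift4 m2 m3 m4 m5 ∧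
      w5 = (4 * m5 + 2) * t + (shift5 m1 m3 m4 m5 + 1)) := by
  obtain ⟨q, hq⟩ := h
  -- The coordinates of w in the basis of L are p_i + (w3 + w5)/2: the parity of w3 + w5 is even on
  -- L and odd on h + L. Doubling avoids fractions.
  obtain ⟨p1, p2, p3, p4, p5, h1, h2, h3, h4, h5⟩ : ∃ p1 p2 p3 p4 p5 : ℤ,
      2 * w1 = 4 * (2 * p1 + w3 + w5) * t + shift1 (2 * p1 + w3 + w5) (2 * p2 + w3 + w5)
        (2 * p3 + w3 + w5) (2 * p5 + w3 + w5) ∧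
      2 * w2 = 4 * (2 * p2 + w3 + w5) * t + shift2 (2 * p1 + w3 + w5) (2 * p2 + w3 + w5)
        (2 * p4 + w3 + w5) ∧
      2 * w3 = 4 * (2 * p3 + w3 + w5) * t + shift3 (2 * p1 + w3 + w5) (2 * p3 + w3 + w5)
        (2 * p4 + w3 + w5) (2 * p5 + w3 + w5) ∧
      2 * w4 = 4 * (2 * p4 + w3 + w5) * t + shift4 (2 * p2 + w3 + w5) (2 * p3 + w3 + w5)
        (2 * p4 + w3 + w5) (2 * p5 + w3 + w5) ∧
      2 * w5 = 4 * (2 * p5 + w3 + w5) * t + shift5 (2 * p1 + w3 + w5) (2 * p3 + w3 + w5)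
        (2 * p4 + w3 + w5) (2 * p5 + w3 + w5) := by
    -- Found by inverting M and eliminating w1 through `hq`, after which the denominators cancel.
    refine ⟨
      q * (128 * t ^ 4 + 160 * t ^ 3 + 104 * t ^ 2 + 36 * t + 5)
        - w2 * (32 * t ^ 3 + 40 * t ^ 2 + 22 * t + 7) - w3 * (64 * t ^ 3 + 56 * t ^ 2 + 30 * t + 7)
        - w4 * (64 * t ^ 3 + 64 * t ^ 2 + 36 * t + 9) - w5 * (96 * t ^ 3 + 96 * t ^ 2 + 52 * t + 13),
      q * (32 * t ^ 3 + 24 * t ^ 2 + 8 * t + 1) - w2 * (8 * t ^ 2 + 6 * t + 1)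
        - w3 * (16 * t ^ 2 + 6 * t + 2) - w4 * (16 * t ^ 2 + 8 * t + 2)
        - w5 * (24 * t ^ 2 + 12 * t + 3),
      q * (32 * t ^ 3 + 24 * t ^ 2 + 4 * t) - w2 * (8 * t ^ 2 + 6 * t)
        - w3 * (16 * t ^ 2 + 6 * t) - w4 * (16 * t ^ 2 + 8 * t) - w5 * (24 * t ^ 2 + 12 * t),
      q * (24 * t ^ 2 + 16 * t + 3) - w2 * (6 * t + 4) - w3 * (12 * t + 4) - w4 * (12 * t + 5)
        - w5 * (18 * t + 8),
      -q * (32 * t ^ 3 + 40 * t ^ 2 + 16 * t + 2) + w2 * (8 * t ^ 2 + 10 * t + 3)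
        + w3 * (16 * t ^ 2 + 14 * t + 2) + w4 * (16 * t ^ 2 + 16 * t + 4)
        + w5 * (24 * t ^ 2 + 24 * t + 5), ?_⟩
    have hw : w1 = order t * q - w2 * gen2 t - w3 * gen3 t - w4 * gen4 t - w5 * gen5 t := by
      rw [← hq, eval]
      ring
    subst hw
    simp only [order, gen2, gen3, gen4, gen5, shift1, shift2, shift3, shift4, shift5]
    push_cast
    refine ⟨?_, ?_, ?_, ?_, ?_⟩ <;> ring
  obtain ⟨c, hc⟩ | ⟨c, hc⟩ := Int.even_or_odd (w3 + w5)
  · have hc' : ∀ p : ℤ, 2 * p + w3 + w5 = 2 * (p + c) := fun p => by omega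
    simp only [hc', shift1, shift2, shift3, shift4, shift5] at h1 h2 h3 h4 h5
    refine ⟨p1 + c, p2 + c, p3 + c, p4 + c, p5 + c, Or.inl ?_⟩
    simp only [shift1, shift2, shift3, shift4, shift5]
    refine ⟨?_, ?_, ?_, ?_, ?_⟩ <;> linarith
  · have hc' : ∀ p : ℤ, 2 * p + w3 + w5 = 2 * (p + c) + 1 := fun p => by omega
    simp only [hc', shift1, shift2, shift3, shift4, shift5] at h1 h2 h3 h4 h5
    refine ⟨p1 + c, p2 + c, p3 + c, p4 + c, p5 + c, Or.inr ?_⟩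
    simp only [shift1, shift2, shift3, shift4, shift5]
    refine ⟨?_, ?_, ?_, ?_, ?_⟩ <;> linarith

/-- The corners of a lattice box have distance `10 * t + 3`, so one of them is near. -/
theorem exists_relation_of_mem_latticeBox {T σ d t : ℕ} {m1 m2 m3 m4 m5 e1 e2 e3 e4 e5 : ℤ}
    {x1 x2 x3 x4 x5 : ℤ} (hT : T ≤ 3) (hσ : σ ≤ 1) (ht : (t : ℤ) = T + σ * ((d : ℤ) - 1))
    (hm1 : |m1| ≤ 1) (hm2 : |m2| ≤ 1) (hm3 : |m3| ≤ 1) (hm4 : |m4| ≤ 1) (hm5 : |m5| ≤ 1)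
    (he1 : e1 = 0 ∨ e1 = 1) (he2 : e2 = 0 ∨ e2 = 1) (he3 : e3 = 0 ∨ e3 = 1)
    (he4 : e4 = 0 ∨ e4 = 1) (he5 : e5 = 0 ∨ e5 = 1)
    (hx : (latticeBox T σ m1 m2 m3 m4 m5 e1 e2 e3 e4 e5).Mem d x1 x2 x3 x4 x5) :
    ∃ w1 w2 w3 w4 w5 : ℤ, (order t : ℤ) ∣ eval t w1 w2 w3 w4 w5 ∧
      |x1 - w1| + |x2 - w2| + |x3 - w3| + |x4 - w4| + |x5 - w5| ≤ 5 * t + 1 := by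
  obtain ⟨h1, h2, h3, h4, h5⟩ := hx
  have hu : |x1 - (4 * m1 * t + shift1 m1 m2 m3 m5)| + |x2 - (4 * m2 * t + shift2 m1 m2 m4)| +
      |x3 - (4 * m3 * t + shift3 m1 m3 m4 m5)| + |x4 - (4 * m4 * t + shift4 m2 m3 m4 m5)| +
      |x5 - (4 * m5 * t + shift5 m1 m3 m4 m5)| +
      (|x1 - ((4 * (m1 - e1) + 2) * t + (shift1 (m1 - e1) (m2 - e2) (m3 - e3) (m5 - e5) + 1))| +
      |x2 - ((4 * (m2 - e2) + 2) * t + (shift2 (m1 - e1) (m2 - e2) (m4 - e4) + 1))| +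
      |x3 - ((4 * (m3 - e3) + 2) * t + shift3 (m1 - e1) (m3 - e3) (m4 - e4) (m5 - e5))| +
      |x4 - ((4 * (m4 - e4) + 2) * t + shift4 (m2 - e2) (m3 - e3) (m4 - e4) (m5 - e5))| +
      |x5 - ((4 * (m5 - e5) + 2) * t + (shift5 (m1 - e1) (m3 - e3) (m4 - e4) (m5 - e5) + 1))|) =
      10 * t + 3 := by
    have hb1 := abs_le.1 hm1
    have hb2 := abs_le.1 hm2
    have hb3 := abs_le.1 hm3
    have hb4 := abs_le.1 hm4
    have hb5 := abs_le.1 hm5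
    have hn : ∀ {e : ℤ}, e = 0 ∨ e = 1 → 0 ≤ e ∧ e ≤ 1 := by omega
    have hn1 := hn he1
    have hn2 := hn he2
    have hn3 := hn he3
    have hn4 := hn he4
    have hn5 := hn he5
    have g1 := abs_add_abs_of_mem_side hT hσ ht hm1 he1
      (by rw [abs_le, shift1]; clear * - hb1 hb2 hb3 hb5; omega)
      (by rw [abs_le, shift1]; clear * - hb1 hb2 hb3 hb5 hn1 hn2 hn3 hn5; omega) h1
    have g2 := abs_add_abs_of_mem_side hT hσ ht hm2 he2
      (by rw [abs_le, shift2]; clear * - hb1 hb2 hb4; omega)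
      (by rw [abs_le, shift2]; clear * - hb1 hb2 hb4 hn1 hn2 hn4; omega) h2
    have g3 := abs_add_abs_of_mem_side hT hσ ht hm3 he3
      (by rw [abs_le, shift3]; clear * - hb1 hb3 hb4 hb5; omega)
      (by rw [abs_le, shift3]; clear * - hb1 hb3 hb4 hb5 hn1 hn3 hn4 hn5; omega) h3
    have g4 := abs_add_abs_of_mem_side hT hσ ht hm4 he4
      (by rw [abs_le, shift4]; clear * - hb2 hb3 hb4 hb5; omega)
      (by rw [abs_le, shift4]; clear * - hb2 hb3 hb4 hb5 hn2 hn3 hn4 hn5; omega) h4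
    have g5 := abs_add_abs_of_mem_side hT hσ ht hm5 he5
      (by rw [abs_le, shift5]; clear * - hb1 hb3 hb4 hb5; omega)
      (by rw [abs_le, shift5]; clear * - hb1 hb3 hb4 hb5 hn1 hn3 hn4 hn5; omega) h5
    have hsum : ∀ a1 a2 a3 a4 a5 b1 b2 b3 b4 b5 : ℤ, a1 + a2 + a3 + a4 + a5 +
        (b1 + b2 + b3 + b4 + b5) = (a1 + b1) + (a2 + b2) + (a3 + b3) + (a4 + b4) + (a5 + b5) :=
      fun _ _ _ _ _ _ _ _ _ _ => by ring
    rw [hsum, g1, g2, g3, g4, g5]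
    simp only [shift1, shift2, shift3, shift4, shift5]
    clear * - he1 he2 he3 he4 he5
    -- With s_i = 1 - 2e_i the constant term is s·h₀ - sᵀ(D + A)e, where h₀ = (D + A)𝟙/2 is the
    -- constant part of h. Since sᵀAs = 0, it equals tr(D)/2 = 3 for every choice of e.
    obtain rfl | rfl := he1 <;> obtain rfl | rfl := he2 <;> obtain rfl | rfl := he3 <;>
      obtain rfl | rfl := he4 <;> obtain rfl | rfl := he5 <;> ring
  obtain h | h : _ ∨ _ := le_or_gt (|x1 - (4 * m1 * t + shift1 m1 m2 m3 m5)| +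
      |x2 - (4 * m2 * t + shift2 m1 m2 m4)| + |x3 - (4 * m3 * t + shift3 m1 m3 m4 m5)| +
      |x4 - (4 * m4 * t + shift4 m2 m3 m4 m5)| + |x5 - (4 * m5 * t + shift5 m1 m3 m4 m5)|)
      (5 * t + 1)
  · exact ⟨_, _, _, _, _, ⟨_, eval_lattice t m1 m2 m3 m4 m5⟩, h⟩
  · exact ⟨_, _, _, _, _, ⟨_, eval_lattice_add_half t (m1 - e1) (m2 - e2) (m3 - e3) (m4 - e4)
      (m5 - e5)⟩, by linarith⟩

theorem exists_relation_of_mem_halfCube {T σ d t : ℕ} {x1 x2 x3 x4 x5 : ℤ} (hT : T ≤ 3)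
    (hσ : σ ≤ 1) (ht : (t : ℤ) = T + σ * ((d : ℤ) - 1))
    (hcov : Box.covers 30 (latticeBoxes T σ) (halfCube T σ) = true) (h0 : 0 ≤ x1)
    (h1 : |x1| ≤ 2 * t + 2) (h2 : |x2| ≤ 2 * t + 2) (h3 : |x3| ≤ 2 * t + 2)
    (h4 : |x4| ≤ 2 * t + 2) (h5 : |x5| ≤ 2 * t + 2) :
    ∃ w1 w2 w3 w4 w5 : ℤ, (order t : ℤ) ∣ eval t w1 w2 w3 w4 w5 ∧
      |x1 - w1| + |x2 - w2| + |x3 - w3| + |x4 - w4| + |x5 - w5| ≤ 5 * t + 1 := by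
  have hlo : (endpoint T σ (-2) (-2)).value d = -2 * t + -2 :=
    value_endpoint ht (by omega) (by omega)
  have hz : (endpoint T σ 0 0).value d = 0 * t + 0 := value_endpoint ht (by omega) (by omega)
  have hhi : (endpoint T σ 2 3).value d = 2 * t + 3 := value_endpoint ht (by omega) (by omega)
  have hmem : ∀ {x : ℤ}, |x| ≤ 2 * t + 2 →
      Interval.Mem d ⟨endpoint T σ (-2) (-2), endpoint T σ 2 3⟩ x := by
    intro x hx
    rw [abs_le] at hx
    refine ⟨?_, ?_⟩ <;> simp only [hlo, hhi] <;> linarith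
  have hmem1 : Interval.Mem d ⟨endpoint T σ 0 0, endpoint T σ 2 3⟩ x1 :=
    ⟨by simp only [hz]; linarith, (hmem h1).2⟩
  obtain ⟨b, hb, hbx⟩ := Box.exists_mem_of_covers hcov (d := d) (x1 := x1) (x2 := x2) (x3 := x3)
    (x4 := x4) (x5 := x5) (show _ ∧ _ from
      ⟨hmem1, hmem h2, hmem h3, hmem h4, hmem h5⟩)
  have habs : ∀ {m : ℤ}, m ∈ [0, 1, -1] → |m| ≤ 1 := by decide
  have hbin : ∀ {e : ℤ}, e ∈ [0, 1] → e = 0 ∨ e = 1 := by simp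
  obtain ⟨m1, hm1, hb⟩ := List.mem_flatMap.1 hb
  obtain ⟨m2, hm2, hb⟩ := List.mem_flatMap.1 hb
  obtain ⟨m3, hm3, hb⟩ := List.mem_flatMap.1 hb
  obtain ⟨m4, hm4, hb⟩ := List.mem_flatMap.1 hb
  obtain ⟨m5, hm5, hb⟩ := List.mem_flatMap.1 hb
  obtain ⟨e1, he1, hb⟩ := List.mem_flatMap.1 hb
  obtain ⟨e2, he2, hb⟩ := List.mem_flatMap.1 hb
  obtain ⟨e3, he3, hb⟩ := List.mem_flatMap.1 hb
  obtain ⟨e4, he4, hb⟩ := List.mem_flatMap.1 hb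
  obtain ⟨e5, he5, rfl⟩ := List.mem_map.1 hb
  refine exists_relation_of_mem_latticeBox hT hσ ht ?_ (habs hm2) (habs hm3) (habs hm4) (habs hm5)
    (hbin he1) (hbin he2) (hbin he3) (hbin he4) (hbin he5) hbx
  obtain rfl | rfl := hbin hm1 <;> decide

theorem exists_relation_of_abs_le {t : ℕ} {x1 x2 x3 x4 x5 : ℤ} (ht : 1 ≤ t)
    (h1 : |x1| ≤ 2 * t + 2) (h2 : |x2| ≤ 2 * t + 2) (h3 : |x3| ≤ 2 * t + 2)
    (h4 : |x4| ≤ 2 * t + 2) (h5 : |x5| ≤ 2 * t + 2) :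
    ∃ w1 w2 w3 w4 w5 : ℤ, (order t : ℤ) ∣ eval t w1 w2 w3 w4 w5 ∧
      |x1 - w1| + |x2 - w2| + |x3 - w3| + |x4 - w4| + |x5 - w5| ≤ 5 * t + 1 := by
  have key : ∀ x1 x2 x3 x4 x5 : ℤ, 0 ≤ x1 → |x1| ≤ 2 * t + 2 → |x2| ≤ 2 * t + 2 →
      |x3| ≤ 2 * t + 2 → |x4| ≤ 2 * t + 2 → |x5| ≤ 2 * t + 2 →
      ∃ w1 w2 w3 w4 w5 : ℤ, (order t : ℤ) ∣ eval t w1 w2 w3 w4 w5 ∧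
        |x1 - w1| + |x2 - w2| + |x3 - w3| + |x4 - w4| + |x5 - w5| ≤ 5 * t + 1 := by
    intro x1 x2 x3 x4 x5
    obtain rfl | ht := ht.eq_or_lt
    · exact exists_relation_of_mem_halfCube (d := 0) (by norm_num) (by norm_num) (by norm_num)
        covers_one
    · obtain ⟨d, rfl⟩ := Nat.exists_eq_add_of_lt ht
      exact exists_relation_of_mem_halfCube (d := d) (by norm_num) (by norm_num)
        (by push_cast; ring) covers_symbolic
  obtain h | h := le_total 0 x1
  · exact key _ _ _ _ _ h h1 h2 h3 h4 h5
  · obtain ⟨w1, w2, w3, w4, w5, hw, hd⟩ := key (-x1) (-x2) (-x3) (-x4) (-x5) (by linarith)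
      (by rwa [abs_neg]) (by rwa [abs_neg]) (by rwa [abs_neg]) (by rwa [abs_neg]) (by rwa [abs_neg])
    refine ⟨-w1, -w2, -w3, -w4, -w5, ?_, ?_⟩
    · have e : eval t (-w1) (-w2) (-w3) (-w4) (-w5) = -eval t w1 w2 w3 w4 w5 := by
        simp only [eval]
        ring
      rw [e]
      exact hw.neg_right
    · have hneg : ∀ x w : ℤ, |x - -w| = |-x - w| := fun x w => by rw [← abs_neg]; congr 1; ring
      simpa only [hneg] using hd

/-! ### Reduction to the cube and the upper bound. -/

/-- For a coordinate of a shortest representative: `a` is the diagonal entry of a column of M and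
`b` the number of its entries ±1 off the diagonal. If |y| were above (a + b)/2, a shift by ±a would
shorten the vector. -/
theorem abs_le_of_abs_le_add {y a b B : ℤ} (hab : b < a) (hB : a + b ≤ 2 * B + 1)
    (h : |y| ≤ |y - a| + b) (h' : |y| ≤ |y + a| + b) : |y| ≤ B := by
  rcases abs_cases y with ⟨_, _⟩ | ⟨_, _⟩ <;> rcases abs_cases (y - a) with ⟨_, _⟩ | ⟨_, _⟩ <;>
    rcases abs_cases (y + a) with ⟨_, _⟩ | ⟨_, _⟩ <;> omega

/-- Every element is represented by a combination with coefficients in a cube. -/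
theorem exists_abs_le {t : ℕ} (ht : 1 ≤ t) (y1 y2 y3 y4 y5 : ℤ) : ∃ x1 x2 x3 x4 x5 : ℤ,
    (order t : ℤ) ∣ eval t y1 y2 y3 y4 y5 - eval t x1 x2 x3 x4 x5 ∧
    |x1| ≤ 2 * t + 2 ∧ |x2| ≤ 2 * t + 2 ∧ |x3| ≤ 2 * t + 2 ∧ |x4| ≤ 2 * t + 2 ∧
    |x5| ≤ 2 * t + 2 := by
  obtain ⟨N, hN⟩ : ∃ N : ℕ,
      y1.natAbs + y2.natAbs + y3.natAbs + y4.natAbs + y5.natAbs = N := ⟨_, rfl⟩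
  induction N using Nat.strong_induction_on generalizing y1 y2 y3 y4 y5 with
  | _ N ih =>
    by_contra hcon
    -- A counterexample of least norm cannot be shortened by a relation; below this is applied to
    -- plus and minus each column of M.
    have step : ∀ c1 c2 c3 c4 c5 : ℤ, (order t : ℤ) ∣ eval t c1 c2 c3 c4 c5 →
        |y1| + |y2| + |y3| + |y4| + |y5| ≤
          |y1 - c1| + |y2 - c2| + |y3 - c3| + |y4 - c4| + |y5 - c5| := by
      intro c1 c2 c3 c4 c5 hc
      by_contra! hlt
      simp only [← Int.natCast_natAbs] at hlt
      rw [← hN] at ih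
      obtain ⟨x1, x2, x3, x4, x5, hdvd, hx⟩ := ih _ (by exact_mod_cast hlt) _ _ _ _ _ rfl
      refine hcon ⟨x1, x2, x3, x4, x5, ?_, hx⟩
      have e : eval t y1 y2 y3 y4 y5 - eval t x1 x2 x3 x4 x5 =
          eval t (y1 - c1) (y2 - c2) (y3 - c3) (y4 - c4) (y5 - c5) - eval t x1 x2 x3 x4 x5 +
            eval t c1 c2 c3 c4 c5 := by
        simp only [eval]
        ring
      rw [e]
      exact dvd_add hdvd hc
    have step' : ∀ c1 c2 c3 c4 c5 : ℤ, (order t : ℤ) ∣ eval t c1 c2 c3 c4 c5 →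
        |y1| + |y2| + |y3| + |y4| + |y5| ≤
          |y1 + c1| + |y2 + c2| + |y3 + c3| + |y4 + c4| + |y5 + c5| := by
      intro c1 c2 c3 c4 c5 hc
      have e : eval t (-c1) (-c2) (-c3) (-c4) (-c5) = -eval t c1 c2 c3 c4 c5 := by
        simp only [eval]
        ring
      have h := step (-c1) (-c2) (-c3) (-c4) (-c5) (by rw [e]; exact hc.neg_right)
      simpa only [sub_neg_eq_add] using h
    have hsub : ∀ y : ℤ, |y - 1| ≤ |y| + 1 := fun y => by simpa using abs_sub y 1
    have hadd : ∀ y : ℤ, |y + 1| ≤ |y| + 1 := fun y => by simpa using abs_add_le y 1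
    have hsub1 := hsub y1
    have hsub2 := hsub y2
    have hsub3 := hsub y3
    have hsub4 := hsub y4
    have hsub5 := hsub y5
    have hadd1 := hadd y1
    have hadd2 := hadd y2
    have hadd3 := hadd y3
    have hadd4 := hadd y4
    have hadd5 := hadd y5
    refine hcon ⟨y1, y2, y3, y4, y5, by simp, ?_, ?_, ?_, ?_, ?_⟩
    · have hc : (order t : ℤ) ∣ eval t (4 * t + 1) (-1) (-1) 0 1 :=
        ⟨0, by simp only [eval, order, gen2, gen3, gen4, gen5]; push_cast; ring⟩
      have h := step _ _ _ _ _ hc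
      have h' := step' _ _ _ _ _ hc
      simp only [sub_neg_eq_add, sub_zero, ← sub_eq_add_neg, add_zero] at h h'
      exact abs_le_of_abs_le_add (a := 4 * t + 1) (b := 3) (by omega) (by omega) (by linarith)
        (by linarith)
    · have hc : (order t : ℤ) ∣ eval t 1 (4 * t + 2) 0 (-1) 0 :=
        ⟨1, by simp only [eval, order, gen2, gen3, gen4, gen5]; push_cast; ring⟩
      have h := step _ _ _ _ _ hc
      have h' := step' _ _ _ _ _ hc
      simp only [sub_neg_eq_add, sub_zero, ← sub_eq_add_neg, add_zero] at h h'
      exact abs_le_of_abs_le_add (a := 4 * t + 2) (b := 2) (by omega) (by omega) (by linarith)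
        (by linarith)
    · have hc : (order t : ℤ) ∣ eval t 1 0 (4 * t + 1) (-1) 1 :=
        ⟨2, by simp only [eval, order, gen2, gen3, gen4, gen5]; push_cast; ring⟩
      have h := step _ _ _ _ _ hc
      have h' := step' _ _ _ _ _ hc
      simp only [sub_neg_eq_add, sub_zero, ← sub_eq_add_neg, add_zero] at h h'
      exact abs_le_of_abs_le_add (a := 4 * t + 1) (b := 3) (by omega) (by omega) (by linarith)
        (by linarith)
    · have hc : (order t : ℤ) ∣ eval t 0 1 1 (4 * t + 1) (-1) :=
        ⟨2, by simp only [eval, order, gen2, gen3, gen4, gen5]; push_cast; ring⟩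
      have h := step _ _ _ _ _ hc
      have h' := step' _ _ _ _ _ hc
      simp only [sub_neg_eq_add, sub_zero, ← sub_eq_add_neg, add_zero] at h h'
      exact abs_le_of_abs_le_add (a := 4 * t + 1) (b := 3) (by omega) (by omega) (by linarith)
        (by linarith)
    · have hc : (order t : ℤ) ∣ eval t (-1) 0 (-1) 1 (4 * t + 1) :=
        ⟨3, by simp only [eval, order, gen2, gen3, gen4, gen5]; push_cast; ring⟩
      have h := step _ _ _ _ _ hc
      have h' := step' _ _ _ _ _ hc
      simp only [sub_neg_eq_add, sub_zero, ← sub_eq_add_neg, add_zero] at h h'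
      exact abs_le_of_abs_le_add (a := 4 * t + 1) (b := 3) (by omega) (by omega) (by linarith)
        (by linarith)

/-- Every combination of the generators is congruent to one of length at most `5 * t + 1`. -/
theorem exists_short_combination {t : ℕ} (ht : 1 ≤ t) (y1 y2 y3 y4 y5 : ℤ) :
    ∃ z1 z2 z3 z4 z5 : ℤ, (order t : ℤ) ∣ eval t y1 y2 y3 y4 y5 - eval t z1 z2 z3 z4 z5 ∧
      |z1| + |z2| + |z3| + |z4| + |z5| ≤ 5 * t + 1 := by
  obtain ⟨x1, x2, x3, x4, x5, hdvd, h1, h2, h3, h4, h5⟩ := exists_abs_le ht y1 y2 y3 y4 y5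
  obtain ⟨w1, w2, w3, w4, w5, hw, hz⟩ := exists_relation_of_abs_le ht h1 h2 h3 h4 h5
  refine ⟨_, _, _, _, _, ?_, hz⟩
  have e : eval t y1 y2 y3 y4 y5 - eval t (x1 - w1) (x2 - w2) (x3 - w3) (x4 - w4) (x5 - w5) =
      eval t y1 y2 y3 y4 y5 - eval t x1 x2 x3 x4 x5 + eval t w1 w2 w3 w4 w5 := by
    simp only [eval]
    ring
  rw [e]
  exact dvd_add hdvd hw

/-! ### The lower bound. -/

theorem add_mul_le_abs_sub {x c m : ℤ} (hx : 0 ≤ x) (hc : 0 ≤ c) :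
    x + |m| * (c - 2 * x) ≤ |x - c * m| := by
  obtain rfl | hm := eq_or_ne m 0
  · simp [abs_of_nonneg hx]
  · have h1 : 1 ≤ |m| := Int.one_le_abs hm
    have h2 : c * |m| - x ≤ |x - c * m| := by
      have := abs_sub_abs_le_abs_sub (c * m) x
      rwa [abs_mul, abs_of_nonneg hc, abs_of_nonneg hx, abs_sub_comm] at this
    nlinarith

/-- Points well inside an orthant are not brought closer to the origin by lattice translations. -/
theorem add_le_abs_sub_lattice {t y1 y2 y3 y4 y5 : ℤ} (h1 : 0 ≤ y1) (h2 : 0 ≤ y2) (h3 : 0 ≤ y3)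
    (h4 : 0 ≤ y4) (h5 : 0 ≤ y5) (h1' : y1 + 1 ≤ 2 * t) (h2' : y2 + 1 ≤ 2 * t)
    (h3' : y3 + 1 ≤ 2 * t) (h4' : y4 + 1 ≤ 2 * t) (h5' : y5 + 1 ≤ 2 * t) (m1 m2 m3 m4 m5 : ℤ) :
    y1 + y2 + y3 + y4 + y5 ≤ |y1 - (4 * m1 * t + shift1 m1 m2 m3 m5)| +
      |y2 - (4 * m2 * t + shift2 m1 m2 m4)| + |y3 - (4 * m3 * t + shift3 m1 m3 m4 m5)| +
      |y4 - (4 * m4 * t + shift4 m2 m3 m4 m5)| + |y5 - (4 * m5 * t + shift5 m1 m3 m4 m5)| := by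
  have ht : 0 ≤ t := by linarith
  have key : ∀ u a b c d : ℤ, |u| - |a| - |b| - |c| - |d| ≤ |u - (a + b + c + d)| := by
    intro u a b c d
    have := abs_sub_abs_le_abs_sub u (a + b + c + d)
    have := abs_add_le (a + b + c) d
    have := abs_add_le (a + b) c
    have := abs_add_le a b
    linarith
  have e1 : y1 - (4 * m1 * t + shift1 m1 m2 m3 m5) =
      y1 - (4 * t + 1) * m1 - (m2 + m3 + -m5 + 0) := by rw [shift1]; ring
  have e2 : y2 - (4 * m2 * t + shift2 m1 m2 m4) =
      y2 - (4 * t + 2) * m2 - (-m1 + m4 + 0 + 0) := by rw [shift2]; ring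
  have e3 : y3 - (4 * m3 * t + shift3 m1 m3 m4 m5) =
      y3 - (4 * t + 1) * m3 - (-m1 + m4 + -m5 + 0) := by rw [shift3]; ring
  have e4 : y4 - (4 * m4 * t + shift4 m2 m3 m4 m5) =
      y4 - (4 * t + 1) * m4 - (-m2 + -m3 + m5 + 0) := by rw [shift4]; ring
  have e5 : y5 - (4 * m5 * t + shift5 m1 m3 m4 m5) =
      y5 - (4 * t + 1) * m5 - (m1 + m3 + -m4 + 0) := by rw [shift5]; ring
  rw [e1, e2, e3, e4, e5]
  have k1 := key (y1 - (4 * t + 1) * m1) m2 m3 (-m5) 0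
  have k2 := key (y2 - (4 * t + 2) * m2) (-m1) m4 0 0
  have k3 := key (y3 - (4 * t + 1) * m3) (-m1) m4 (-m5) 0
  have k4 := key (y4 - (4 * t + 1) * m4) (-m2) (-m3) m5 0
  have k5 := key (y5 - (4 * t + 1) * m5) m1 m3 (-m4) 0
  simp only [abs_neg, abs_zero] at k1 k2 k3 k4 k5
  have b1 := add_mul_le_abs_sub (m := m1) h1 (show 0 ≤ 4 * t + 1 by linarith)
  have b2 := add_mul_le_abs_sub (m := m2) h2 (show 0 ≤ 4 * t + 2 by linarith)
  have b3 := add_mul_le_abs_sub (m := m3) h3 (show 0 ≤ 4 * t + 1 by linarith)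
  have b4 := add_mul_le_abs_sub (m := m4) h4 (show 0 ≤ 4 * t + 1 by linarith)
  have b5 := add_mul_le_abs_sub (m := m5) h5 (show 0 ≤ 4 * t + 1 by linarith)
  -- The diagonal gains at least 3, 4, 3, 3, 3 times |m_i|, while the off-diagonal entries of the
  -- columns, numbering 3, 2, 3, 3, 3, cost at most that many times |m_i|.
  have c1 := mul_le_mul_of_nonneg_left (show 3 ≤ 4 * t + 1 - 2 * y1 by linarith) (abs_nonneg m1)
  have c2 := mul_le_mul_of_nonneg_left (show 4 ≤ 4 * t + 2 - 2 * y2 by linarith) (abs_nonneg m2)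
  have c3 := mul_le_mul_of_nonneg_left (show 3 ≤ 4 * t + 1 - 2 * y3 by linarith) (abs_nonneg m3)
  have c4 := mul_le_mul_of_nonneg_left (show 3 ≤ 4 * t + 1 - 2 * y4 by linarith) (abs_nonneg m4)
  have c5 := mul_le_mul_of_nonneg_left (show 3 ≤ 4 * t + 1 - 2 * y5 by linarith) (abs_nonneg m5)
  linarith [abs_nonneg m2]

/-- The far vertex is represented by (t+1, t, t, t, t). The bound t ≥ 2 is what makes its largest
coordinate, t + 1, at most 2t - 1. -/
theorem le_of_dvd_eval_sub {t : ℕ} (ht : 2 ≤ t) {z1 z2 z3 z4 z5 : ℤ}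
    (h : (order t : ℤ) ∣ eval t (t + 1) t t t t - eval t z1 z2 z3 z4 z5) :
    5 * t + 1 ≤ |z1| + |z2| + |z3| + |z4| + |z5| := by
  have e : eval t (t + 1) t t t t - eval t z1 z2 z3 z4 z5 =
      eval t (t + 1 - z1) (t - z2) (t - z3) (t - z4) (t - z5) := by
    simp only [eval]
    ring
  rw [e] at h
  have hz : ∀ {y z w : ℤ}, y - z = w → z = y - w := by intros; linarith
  obtain ⟨m1, m2, m3, m4, m5, ⟨h1, h2, h3, h4, h5⟩ | ⟨h1, h2, h3, h4, h5⟩⟩ :=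
    exists_lattice_of_dvd_eval h
  · rw [hz h1, hz h2, hz h3, hz h4, hz h5]
    refine le_trans (le_of_eq ?_) (add_le_abs_sub_lattice (by omega) (by omega) (by omega)
      (by omega) (by omega) (by omega) (by omega) (by omega) (by omega) (by omega) m1 m2 m3 m4 m5)
    ring
  -- Subtracting h and changing sign turns the vector into (t, t+1, t, t, t+1), of norm 5t + 2,
  -- again well inside the orthant.
  · have hz' : ∀ {z a b : ℤ}, -z = a - b → |z| = |a - b| := fun h => by rw [← h, abs_neg]
    have e1 : |z1| = |(t : ℤ) - (4 * -m1 * t + shift1 (-m1) (-m2) (-m3) (-m5))| :=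
      hz' (by rw [hz h1]; simp only [shift1]; ring)
    have e2 : |z2| = |(t + 1 : ℤ) - (4 * -m2 * t + shift2 (-m1) (-m2) (-m4))| :=
      hz' (by rw [hz h2]; simp only [shift2]; ring)
    have e3 : |z3| = |(t : ℤ) - (4 * -m3 * t + shift3 (-m1) (-m3) (-m4) (-m5))| :=
      hz' (by rw [hz h3]; simp only [shift3]; ring)
    have e4 : |z4| = |(t : ℤ) - (4 * -m4 * t + shift4 (-m2) (-m3) (-m4) (-m5))| :=
      hz' (by rw [hz h4]; simp only [shift4]; ring)
    have e5 : |z5| = |(t + 1 : ℤ) - (4 * -m5 * t + shift5 (-m1) (-m3) (-m4) (-m5))| :=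
      hz' (by rw [hz h5]; simp only [shift5]; ring)
    rw [e1, e2, e3, e4, e5]
    refine le_trans (show (5 * t + 1 : ℤ) ≤ t + (t + 1) + t + t + (t + 1) by linarith)
      (add_le_abs_sub_lattice (by omega) (by omega) (by omega) (by omega) (by omega)
      (by omega) (by omega) (by omega) (by omega) (by omega) _ _ _ _ _)

/-! ### Degree, distinctness of the generators, and small cases. -/

theorem ncard_eq_length_of_natCast {n : ℕ} {l : List ℕ} (hl : l.Pairwise (· < ·))
    (hn : ∀ a ∈ l, a < n) {S : Set (ZMod n)} (hS : ∀ x, x ∈ S ↔ ∃ a ∈ l, (a : ZMod n) = x) :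
    S.ncard = l.length := by
  classical
  have hS' : S = ((l.map (Nat.cast : ℕ → ZMod n)).toFinset : Set (ZMod n)) := by
    ext x
    simp [hS]
  rw [hS', Set.ncard_coe_finset, List.toFinset_card_of_nodup, List.length_map]
  refine List.Nodup.map_on ?_ (hl.imp ne_of_lt)
  intro a ha b hb hab
  rw [ZMod.natCast_eq_natCast_iff'] at hab
  rwa [Nat.mod_eq_of_lt (hn a ha), Nat.mod_eq_of_lt (hn b hb)] at hab

theorem ncard_neighborSet_circulantGraph {n a b c d e : ℕ} (ha : 0 < a) (hab : a < b) (hbc : b < c)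
    (hcd : c < d) (hde : d < e) (he : 2 * e < n) {S : Set (ZMod n)}
    (hS : ∀ x, x ∈ S ∨ -x ∈ S ↔ (x = a ∨ x = b ∨ x = c ∨ x = d ∨ x = e) ∨
      (-x = a ∨ -x = b ∨ -x = c ∨ -x = d ∨ -x = e)) (v : ZMod n) :
    ((SimpleGraph.circulantGraph S).neighborSet v).ncard = 10 := by
  have hsub : ∀ {a : ℕ}, a < n → ((n - a : ℕ) : ZMod n) = -a := by
    intro a h
    rw [Nat.cast_sub h.le, ZMod.natCast_self, zero_sub]
  have hne : ∀ {a : ℕ}, 0 < a → a < n → (a : ZMod n) ≠ 0 := by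
    intro a h0 h h'
    exact absurd (Nat.le_of_dvd h0 ((ZMod.natCast_eq_zero_iff a n).1 h')) (not_le.2 h)
  have himg : (SimpleGraph.circulantGraph S).neighborSet v =
      (fun x => v + x) '' {x | x ∈ S ∨ -x ∈ S} := by
    ext w
    simp only [SimpleGraph.mem_neighborSet, SimpleGraph.circulantGraph_adj, Set.mem_image,
      Set.mem_ofPred_eq]
    constructor
    · rintro ⟨-, h⟩
      exact ⟨w - v, by rwa [neg_sub, or_comm], by abel⟩
    · rintro ⟨x, hx, rfl⟩
      refine ⟨fun h => ?_, by simpa [or_comm] using hx⟩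
      have hx0 : x = 0 := by simpa using h
      rw [hS, hx0, neg_zero, or_self] at hx
      rcases hx with h | h | h | h | h
      · exact hne ha (by omega) h.symm
      · exact hne (a := b) (by omega) (by omega) h.symm
      · exact hne (a := c) (by omega) (by omega) h.symm
      · exact hne (a := d) (by omega) (by omega) h.symm
      · exact hne (a := e) (by omega) (by omega) h.symm
  rw [himg, Set.ncard_image_of_injective _ (add_right_injective v)]
  refine ncard_eq_length_of_natCast (l := [a, b, c, d, e, n - e, n - d, n - c, n - b, n - a])
    ?_ ?_ ?_
  · simp only [List.pairwise_cons, List.mem_cons, List.not_mem_nil, or_false, List.Pairwise.nil,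
      forall_eq_or_imp, forall_eq, and_true, false_imp_iff, implies_true]
    omega
  · simp only [List.mem_cons, List.not_mem_nil, or_false, forall_eq_or_imp, forall_eq]
    omega
  · intro x
    rw [Set.mem_ofPred_eq, hS]
    simp only [List.mem_cons, List.not_mem_nil, or_false, exists_eq_or_imp, exists_eq_left]
    rw [hsub (show a < n by omega), hsub (show b < n by omega), hsub (show c < n by omega),
      hsub (show d < n by omega), hsub (show e < n by omega)]
    simp only [neg_eq_iff_eq_neg, eq_comm (a := x)]
    tauto

theorem one_lt_gen2 (t : ℕ) : 1 < gen2 t := by unfold gen2; omega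

theorem gen2_lt_gen3 {t : ℕ} (ht : 1 ≤ t) : gen2 t < gen3 t := by
  obtain ⟨s, rfl⟩ := Nat.exists_eq_add_of_le ht
  unfold gen2 gen3
  ring_nf
  omega

theorem gen3_lt_gen4 (t : ℕ) : gen3 t < gen4 t := by
  unfold gen3 gen4
  omega

theorem gen4_lt_gen5 (t : ℕ) : gen4 t < gen5 t := by
  unfold gen4 gen5
  omega

theorem two_mul_gen5_lt_order {t : ℕ} (ht : 2 ≤ t) : 2 * gen5 t < order t := by
  obtain ⟨s, rfl⟩ := Nat.exists_eq_add_of_le ht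
  unfold gen5 order
  ring_nf
  omega

theorem intCast_eval (t : ℕ) (z1 z2 z3 z4 z5 : ℤ) : ((eval t z1 z2 z3 z4 z5 : ℤ) : ZMod (order t)) =
    z1 • (1 : ZMod (order t)) + z2 • (gen2 t : ZMod (order t)) + z3 • (gen3 t : ZMod (order t)) +
      z4 • (gen4 t : ZMod (order t)) + z5 • (gen5 t : ZMod (order t)) := by
  simp only [eval, zsmul_eq_mul]
  push_cast
  ring

/-- For t = 1 the dominance argument fails, so all vectors of norm at most 5 are checked; n = 2380,
and the far vertex (2, 1, 1, 1, 1) evaluates to 3778. -/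
theorem six_le_of_dvd_eval_sub {z1 z2 z3 z4 z5 : ℤ}
    (h : (order 1 : ℤ) ∣ eval 1 2 1 1 1 1 - eval 1 z1 z2 z3 z4 z5) :
    6 ≤ z1.natAbs + z2.natAbs + z3.natAbs + z4.natAbs + z5.natAbs := by
  have key : ∀ a ∈ Finset.Icc (-5 : ℤ) 5, ∀ b ∈ Finset.Icc (-(5 - a.natAbs) : ℤ) (5 - a.natAbs),
      ∀ c ∈ Finset.Icc (-(5 - a.natAbs - b.natAbs) : ℤ) (5 - a.natAbs - b.natAbs),
      ∀ d ∈ Finset.Icc (-(5 - a.natAbs - b.natAbs - c.natAbs) : ℤ)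
        (5 - a.natAbs - b.natAbs - c.natAbs),
      ∀ e ∈ Finset.Icc (-(5 - a.natAbs - b.natAbs - c.natAbs - d.natAbs) : ℤ)
        (5 - a.natAbs - b.natAbs - c.natAbs - d.natAbs),
      ¬ (2380 : ℤ) ∣ 3778 - (a + b * 555 + c * 860 + d * 951 + e * 1410) := by
    decide +kernel
  by_contra hlt
  refine key z1 ?_ z2 ?_ z3 ?_ z4 ?_ z5 ?_ ?_
  · rw [Finset.mem_Icc]; omega
  · rw [Finset.mem_Icc]; omega
  · rw [Finset.mem_Icc]; omega
  · rw [Finset.mem_Icc]; omega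
  · rw [Finset.mem_Icc]; omega
  · simpa [order, eval, gen2, gen3, gen4, gen5] using h

theorem ediam_eq {t : ℕ} (ht : 1 ≤ t) :
    (SimpleGraph.circulantGraph {(1 : ZMod (order t)), (gen2 t : ZMod (order t)),
      (gen3 t : ZMod (order t)), (gen4 t : ZMod (order t)), (gen5 t : ZMod (order t))}).ediam =
      (5 * t + 1 : ℕ) := by
  refine SimpleGraph.ediam_circulantGraph_eq (fun a => ?_)
    ⟨(eval t (t + 1) t t t t : ℤ), fun z1 z2 z3 z4 z5 h => ?_⟩
  · obtain ⟨y, rfl⟩ := ZMod.intCast_surjective a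
    obtain ⟨z1, z2, z3, z4, z5, hdvd, hz⟩ := exists_short_combination ht y 0 0 0 0
    refine ⟨z1, z2, z3, z4, z5, ?_, ?_⟩
    · rw [← intCast_eval, eq_comm, ZMod.intCast_eq_intCast_iff_dvd_sub]
      simpa [eval] using hdvd
    · simp only [← Int.natCast_natAbs] at hz
      exact_mod_cast hz
  · rw [← intCast_eval, eq_comm, ZMod.intCast_eq_intCast_iff_dvd_sub] at h
    obtain rfl | ht := ht.eq_or_lt
    · exact six_le_of_dvd_eval_sub h
    · have hz := le_of_dvd_eval_sub ht h
      simp only [← Int.natCast_natAbs] at hz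
      exact_mod_cast hz

/-- Here n = 8, and G ∪ -G contains all nonzero residues, so the graph is complete. -/
theorem ediam_zero :
    (SimpleGraph.circulantGraph {(1 : ZMod (order 0)), (gen2 0 : ZMod (order 0)),
      (gen3 0 : ZMod (order 0)), (gen4 0 : ZMod (order 0)), (gen5 0 : ZMod (order 0))}).ediam =
      1 := by
  have key : ∀ u v : ZMod 8, u ≠ v →
      (u - v = 1 ∨ u - v = 11 ∨ u - v = 10 ∨ u - v = 15 ∨ u - v = 20) ∨
        (v - u = 1 ∨ v - u = 11 ∨ v - u = 10 ∨ v - u = 15 ∨ v - u = 20) := by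
    decide
  have : Nontrivial (ZMod (order 0)) :=
    ZMod.nontrivial_iff.2 (by decide)
  rw [SimpleGraph.ediam_eq_one, eq_top_iff]
  intro u v huv
  rw [SimpleGraph.circulantGraph_adj]
  exact ⟨huv, key u v huv⟩

theorem ncard_generators (t : ℕ) :
    ({(1 : ZMod (order t)), (gen2 t : ZMod (order t)), (gen3 t : ZMod (order t)),
      (gen4 t : ZMod (order t)), (gen5 t : ZMod (order t))} : Set (ZMod (order t))).ncard = 5 := by
  obtain rfl | ht := Nat.eq_zero_or_pos t
  -- Modulo 8 the generators 11, 10, 15, 20 are 3, 2, 7, 4.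
  · refine ncard_eq_length_of_natCast (l := [1, 2, 3, 4, 7]) (by decide) (by decide) ?_
    have key : ∀ x : ZMod 8, (x = 1 ∨ x = 11 ∨ x = 10 ∨ x = 15 ∨ x = 20) ↔
        ∃ a ∈ [1, 2, 3, 4, 7], ((a : ℕ) : ZMod 8) = x := by
      decide
    exact key
  · have h5 : gen5 t < order t := by
      obtain ⟨s, rfl⟩ := Nat.exists_eq_add_of_le ht
      unfold gen5 order
      ring_nf
      omega
    have h1 := one_lt_gen2 t
    have h2 := gen2_lt_gen3 ht
    have h3 := gen3_lt_gen4 t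
    have h4 := gen4_lt_gen5 t
    refine ncard_eq_length_of_natCast (l := [1, gen2 t, gen3 t, gen4 t, gen5 t]) ?_ ?_ fun x => ?_
    · simp only [List.pairwise_cons, List.mem_cons, List.not_mem_nil, or_false, List.Pairwise.nil,
        forall_eq_or_imp, forall_eq, and_true, false_imp_iff, implies_true]
      omega
    · simp only [List.mem_cons, List.not_mem_nil, or_false, forall_eq_or_imp, forall_eq]
      omega
    · simp [eq_comm]

theorem ncard_neighborSet {t : ℕ} (ht : 1 ≤ t) (v : ZMod (order t)) :
    ((SimpleGraph.circulantGraph {(1 : ZMod (order t)), (gen2 t : ZMod (order t)),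
      (gen3 t : ZMod (order t)), (gen4 t : ZMod (order t)),
      (gen5 t : ZMod (order t))}).neighborSet v).ncard = 10 := by
  obtain rfl | ht' := ht.eq_or_lt
  -- The last generator, 1410, exceeds n/2 = 1190, so it is replaced by its negative 970 modulo
  -- 2380.
  · refine ncard_neighborSet_circulantGraph (a := 1) (b := 555) (c := 860) (d := 951) (e := 970)
      (by decide) (by decide) (by decide) (by decide) (by decide) (by decide) (fun x => ?_) v
    have h : ((1410 : ℕ) : ZMod (order 1)) = -((970 : ℕ) : ZMod (order 1)) := by
      rw [eq_neg_iff_add_eq_zero, ← Nat.cast_add]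
      exact ZMod.natCast_self (order 1)
    have e2 : gen2 1 = 555 := rfl
    have e3 : gen3 1 = 860 := rfl
    have e4 : gen4 1 = 951 := rfl
    have e5 : gen5 1 = 1410 := rfl
    simp only [Set.mem_insert_iff, Set.mem_singleton_iff, e2, e3, e4, e5, h, neg_inj, Nat.cast_one]
    have hx : x = -((970 : ℕ) : ZMod (order 1)) ↔ -x = ((970 : ℕ) : ZMod (order 1)) :=
      neg_eq_iff_eq_neg.symm
    rw [hx]
    tauto
  · refine ncard_neighborSet_circulantGraph one_pos (one_lt_gen2 t) (gen2_lt_gen3 ht)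
      (gen3_lt_gen4 t) (gen4_lt_gen5 t) (two_mul_gen5_lt_order ht') (fun x => ?_) v
    simp only [Set.mem_insert_iff, Set.mem_singleton_iff, Nat.cast_one]

end Degree10

/-- Orders and generators are natural numbers given by exact rational equations, so integrality of
the displayed quotients is part of the claim. `SimpleGraph.circulantGraph S` is the undirected
Cayley graph of `ZMod n` with connection set `S ∪ -S`. -/
theorem theorem4 (k : ℕ) (hk : k ≡ 1 [MOD 5]) :
    ∃ n g₂ g₃ g₄ g₅ : ℕ,
      (n : ℚ) = (512 * (k : ℚ) ^ 5 + 1280 * (k : ℚ) ^ 4 + 6560 * (k : ℚ) ^ 3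
        + 9520 * (k : ℚ) ^ 2 + 6100 * (k : ℚ) + 1028) / 3125 ∧
      (g₂ : ℚ) = (128 * (k : ℚ) ^ 4 + 448 * (k : ℚ) ^ 3 + 1688 * (k : ℚ) ^ 2
        + 3768 * (k : ℚ) + 843) / 625 ∧
      (g₃ : ℚ) = (256 * (k : ℚ) ^ 4 + 416 * (k : ℚ) ^ 3 + 2816 * (k : ℚ) ^ 2
        + 2346 * (k : ℚ) + 416) / 625 ∧
      (g₄ : ℚ) = (256 * (k : ℚ) ^ 4 + 576 * (k : ℚ) ^ 3 + 3136 * (k : ℚ) ^ 2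
        + 3976 * (k : ℚ) + 1431) / 625 ∧
      (g₅ : ℚ) = (384 * (k : ℚ) ^ 4 + 864 * (k : ℚ) ^ 3 + 4504 * (k : ℚ) ^ 2
        + 5614 * (k : ℚ) + 1134) / 625 ∧
      Nat.card (ZMod n) = n ∧
      ∃ S : Set (ZMod n),
        S = {1, (g₂ : ZMod n), (g₃ : ZMod n), (g₄ : ZMod n), (g₅ : ZMod n)} ∧
        S.ncard = 5 ∧
        AddSubgroup.closure S = ⊤ ∧
        (SimpleGraph.circulantGraph S).ediam = (k : ℕ∞) ∧
        (6 ≤ k → ∀ v : ZMod n, ((SimpleGraph.circulantGraph S).neighborSet v).ncard = 10) := by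
  obtain ⟨t, rfl⟩ : ∃ t, k = 5 * t + 1 := ⟨k / 5, by
    have : k % 5 = 1 := hk
    omega⟩
  refine ⟨Degree10.order t, Degree10.gen2 t, Degree10.gen3 t, Degree10.gen4 t, Degree10.gen5 t,
    ?_, ?_, ?_, ?_, ?_, Nat.card_zmod _, _, rfl, Degree10.ncard_generators t, ?_, ?_,
    fun h => Degree10.ncard_neighborSet (by omega)⟩
  · rw [Degree10.order]
    push_cast
    ring
  · rw [Degree10.gen2]
    push_cast
    ring
  · rw [Degree10.gen3]
    push_cast
    ring
  · rw [Degree10.gen4]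
    push_cast
    ring
  · rw [Degree10.gen5]
    push_cast
    ring
  · refine (AddSubgroup.eq_top_iff' _).2 fun x => ?_
    obtain ⟨y, rfl⟩ := ZMod.intCast_surjective x
    rw [← zsmul_one]
    exact zsmul_mem (AddSubgroup.subset_closure (Set.mem_insert _ _)) y
  · obtain rfl | ht := Nat.eq_zero_or_pos t
    · exact Degree10.ediam_zero
    · exact Degree10.ediam_eq ht
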